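/- All locally convex spaces are Hausdorff and over $\mathbb{C}$. For a locally convex space $X$ let $X^\star$ be the space of continuous linear functionals on $X$ with the topology of uniform convergence on totally bounded subsets of $X$, and for $U\subseteq X$ let $U^\circ=\{f\in X^\star:\ |f(x)|\le 1 \text{ for all } x\in U\}$. For locally convex spaces $X$ and $Y$ the primary tensor product $X\cdot Y$ is the space of continuous linear maps $\varphi:X^\star\to Y$ with the topology of uniform convergence on the polars $U^\circ$ of neighbourhoods of zero $U\subseteq X$. Let $X\widetilde\otimes_\varepsilon Y$ and $X\widetilde\otimes_\pi Y$ be the completions of the algebraic tensor product $X\otimes Y$ in the injective topology (generated by the seminorms $\sum_i x_i\otimes y_i\mapsto\sup_{f\in U^\circ,\,g\in V^\circ}\left|\sum_i f(x_i)g(y_i)\right|$, where $U$ and $V$ are neighbourhoods of zero in $X$ and $Y$) and in the projective topology (the finest locally convex topology for which $X\times Y\to X\otimes Y$ is continuous), respectively. Let $X$ and $Y$ be complete locally convex spaces, and suppose that $Y$ has the classical approximation property: the identity map of $Y$ can be approximated, uniformly on totally bounded sets, by continuous linear operators of finite rank. Then there is an isomorphism of locally convex spaces (a linear homeomorphism)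 $$X\cdot Y\;\cong\; X\widetilde\otimes_\varepsilon Y,$$ under which $x\otimes y$ corresponds to the operator $f\mapsto f(x)\,y$. If, in addition, $Y$ is nuclear, then also $$X\cdot Y\;\cong\; X\widetilde\otimes_\varepsilon Y\;\cong\; X\widetilde\otimes_\pi Y,$$ where the isomorphisms are linear homeomorphisms, the second one carries $x\otimes y$ to $x\otimes y$, and the resulting isomorphism $X\cdot Y\cong X\widetilde\otimes_\pi Y$ again lets $x\otimes y$ correspond to $f\mapsto f(x)\,y$. -/

import Mathlib

open Topology Filter Set
open scoped TensorProduct UniformConvergence NNReal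

noncomputable section

namespace StereotypeTensor

universe u v

/-- The stereotype dual `X⋆`: continuous linear functionals on `X` with the topology of uniform
convergence on totally bounded sets. -/
abbrev StarDual (X : Type u) [AddCommGroup X] [Module ℂ X] [UniformSpace X] : Type u :=
  UniformConvergenceCLM (RingHom.id ℂ) (E := X) ℂ {S : Set X | TotallyBounded S}

/-- The polar `A° = {f ∈ X⋆ : |f x| ≤ 1 for all x ∈ A}`. -/
def polarSet {X : Type u} [AddCommGroup X] [Module ℂ X] [UniformSpace X] (A : Set X) :
    Set (StarDual X) :=
  {f | ∀ x ∈ A, ‖f x‖ ≤ 1}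

/-- The family of polars `U°` of neighbourhoods of zero `U ⊆ X`. -/
def nhdsPolars (X : Type u) [AddCommGroup X] [Module ℂ X] [UniformSpace X] :
    Set (Set (StarDual X)) :=
  {K | ∃ U ∈ 𝓝 (0 : X), K = polarSet U}

/-- The primary tensor product `X · Y`: continuous linear maps `X⋆ → Y` with the topology of
uniform convergence on polars of neighbourhoods of zero in `X`. -/
abbrev PrimaryTensor (X : Type u) (Y : Type v)
    [AddCommGroup X] [Module ℂ X] [UniformSpace X]
    [AddCommGroup Y] [Module ℂ Y] [UniformSpace Y] : Type (max u v) :=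
  UniformConvergenceCLM (RingHom.id ℂ) (E := StarDual X) Y (nhdsPolars X)

/-! ### The injective tensor product -/

/-- The algebraic tensor product, to be given the injective topology `ε`. -/
def InjTensor (X : Type u) (Y : Type v) [AddCommGroup X] [Module ℂ X]
    [AddCommGroup Y] [Module ℂ Y] : Type (max u v) := X ⊗[ℂ] Y

instance (X : Type u) (Y : Type v) [AddCommGroup X] [Module ℂ X]
    [AddCommGroup Y] [Module ℂ Y] : AddCommGroup (InjTensor X Y) :=
  inferInstanceAs (AddCommGroup (X ⊗[ℂ] Y))

instance (X : Type u) (Y : Type v) [AddCommGroup X] [Module ℂ X]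
    [AddCommGroup Y] [Module ℂ Y] : Module ℂ (InjTensor X Y) :=
  inferInstanceAs (Module ℂ (X ⊗[ℂ] Y))

/-- The elementary tensor `x ⊗ y` in `InjTensor X Y`. -/
def InjTensor.tmul {X : Type u} {Y : Type v} [AddCommGroup X] [Module ℂ X]
    [AddCommGroup Y] [Module ℂ Y] (x : X) (y : Y) : InjTensor X Y := x ⊗ₜ[ℂ] y

/-- The value of `f ⊗ g` on a tensor: `∑ xᵢ ⊗ yᵢ ↦ ∑ f xᵢ * g yᵢ`. -/
def pairing {X : Type u} {Y : Type v} [AddCommGroup X] [Module ℂ X]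
    [AddCommGroup Y] [Module ℂ Y] (f : X →ₗ[ℂ] ℂ) (g : Y →ₗ[ℂ] ℂ) : X ⊗[ℂ] Y →ₗ[ℂ] ℂ :=
  LinearMap.mul' ℂ ℂ ∘ₗ TensorProduct.map f g

/-- The sets `U° × V°`, where `U`, `V` are neighbourhoods of zero in `X`, `Y`. -/
def polarRectangles (X : Type u) (Y : Type v)
    [AddCommGroup X] [Module ℂ X] [UniformSpace X]
    [AddCommGroup Y] [Module ℂ Y] [UniformSpace Y] : Set (Set (StarDual X × StarDual Y)) :=
  {R | ∃ U ∈ 𝓝 (0 : X), ∃ V ∈ 𝓝 (0 : Y), R = polarSet U ×ˢ polarSet V}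

/-- A tensor `z` regarded as the function `(f, g) ↦ (f ⊗ g) z` on `X⋆ × Y⋆`, the functions
carrying the topology of uniform convergence on the sets `U° × V°`. -/
def InjTensor.toFun (X : Type u) (Y : Type v)
    [AddCommGroup X] [Module ℂ X] [UniformSpace X]
    [AddCommGroup Y] [Module ℂ Y] [UniformSpace Y] :
    InjTensor X Y →ₗ[ℂ] ((StarDual X × StarDual Y) →ᵤ[polarRectangles X Y] ℂ) where
  toFun z := UniformOnFun.ofFun _ fun p =>
    pairing (p.1 : X →ₗ[ℂ] ℂ) (p.2 : Y →ₗ[ℂ] ℂ) z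
  map_add' z w := funext fun p =>
    map_add (pairing (p.1 : X →ₗ[ℂ] ℂ) (p.2 : Y →ₗ[ℂ] ℂ)) z w
  map_smul' c z := funext fun p =>
    map_smul (pairing (p.1 : X →ₗ[ℂ] ℂ) (p.2 : Y →ₗ[ℂ] ℂ)) c z

/-- The injective topology `ε` on `X ⊗ Y`: uniform convergence on the sets `U° × V°`. It is the
one given by the seminorms `z ↦ sup {|(f ⊗ g) z| : f ∈ U°, g ∈ V°}`. -/
instance (X : Type u) (Y : Type v)
    [AddCommGroup X] [Module ℂ X] [UniformSpace X]
    [AddCommGroup Y] [Module ℂ Y] [UniformSpace Y] : UniformSpace (InjTensor X Y) :=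
  UniformSpace.comap (InjTensor.toFun X Y) inferInstance

instance (X : Type u) (Y : Type v)
    [AddCommGroup X] [Module ℂ X] [UniformSpace X]
    [AddCommGroup Y] [Module ℂ Y] [UniformSpace Y] : IsUniformAddGroup (InjTensor X Y) :=
  IsUniformAddGroup.comap (InjTensor.toFun X Y)

instance (X : Type u) (Y : Type v)
    [AddCommGroup X] [Module ℂ X] [UniformSpace X]
    [AddCommGroup Y] [Module ℂ Y] [UniformSpace Y] :
    UniformContinuousConstSMul ℂ (InjTensor X Y) :=
  IsUniformInducing.uniformContinuousConstSMul (f := InjTensor.toFun X Y) ⟨rfl⟩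
    (fun c z => map_smul (InjTensor.toFun X Y) c z)

/-- The completed injective tensor product. -/
abbrev CompletedInjTensor (X : Type u) (Y : Type v)
    [AddCommGroup X] [Module ℂ X] [UniformSpace X]
    [AddCommGroup Y] [Module ℂ Y] [UniformSpace Y] : Type (max u v) :=
  UniformSpace.Completion (InjTensor X Y)

/-! ### The projective tensor product -/

/-- The algebraic tensor product, to be given the projective topology `π`. -/
def ProjTensor (X : Type u) (Y : Type v) [AddCommGroup X] [Module ℂ X]
    [AddCommGroup Y] [Module ℂ Y] : Type (max u v) := X ⊗[ℂ] Y

instance (X : Type u) (Y : Type v) [AddCommGroup X] [Module ℂ X]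
    [AddCommGroup Y] [Module ℂ Y] : AddCommGroup (ProjTensor X Y) :=
  inferInstanceAs (AddCommGroup (X ⊗[ℂ] Y))

instance (X : Type u) (Y : Type v) [AddCommGroup X] [Module ℂ X]
    [AddCommGroup Y] [Module ℂ Y] : Module ℂ (ProjTensor X Y) :=
  inferInstanceAs (Module ℂ (X ⊗[ℂ] Y))

/-- The elementary tensor `x ⊗ y` in `ProjTensor X Y`. -/
def ProjTensor.tmul {X : Type u} {Y : Type v} [AddCommGroup X] [Module ℂ X]
    [AddCommGroup Y] [Module ℂ Y] (x : X) (y : Y) : ProjTensor X Y := x ⊗ₜ[ℂ] y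

/-- The locally convex vector space topologies on `X ⊗ Y` for which the bilinear map
`X × Y → X ⊗ Y` is continuous. -/
def projAdmissible (X : Type u) (Y : Type v)
    [AddCommGroup X] [Module ℂ X] [TopologicalSpace X]
    [AddCommGroup Y] [Module ℂ Y] [TopologicalSpace Y] :
    Set (TopologicalSpace (ProjTensor X Y)) :=
  {t | IsTopologicalAddGroup (ProjTensor X Y) ∧ ContinuousSMul ℂ (ProjTensor X Y) ∧
    LocallyConvexSpace ℝ (ProjTensor X Y) ∧
    Continuous fun p : X × Y => ProjTensor.tmul p.1 p.2}

/-- The projective topology `π`: the finest (in Mathlib's order, the least) locally convex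
topology on `X ⊗ Y` for which `X × Y → X ⊗ Y` is continuous. -/
instance (X : Type u) (Y : Type v)
    [AddCommGroup X] [Module ℂ X] [TopologicalSpace X]
    [AddCommGroup Y] [Module ℂ Y] [TopologicalSpace Y] : TopologicalSpace (ProjTensor X Y) :=
  sInf (projAdmissible X Y)

instance (X : Type u) (Y : Type v)
    [AddCommGroup X] [Module ℂ X] [TopologicalSpace X]
    [AddCommGroup Y] [Module ℂ Y] [TopologicalSpace Y] : IsTopologicalAddGroup (ProjTensor X Y) :=
  topologicalAddGroup_sInf fun _ ht => ht.1

instance (X : Type u) (Y : Type v)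
    [AddCommGroup X] [Module ℂ X] [TopologicalSpace X]
    [AddCommGroup Y] [Module ℂ Y] [TopologicalSpace Y] : ContinuousSMul ℂ (ProjTensor X Y) :=
  continuousSMul_sInf fun _ ht => ht.2.1

/-- The infimum defining `π` is attained: `π` is itself one of the topologies over which it
is taken. -/
theorem projTopology_mem (X : Type u) (Y : Type v)
    [AddCommGroup X] [Module ℂ X] [TopologicalSpace X]
    [AddCommGroup Y] [Module ℂ Y] [TopologicalSpace Y] :
    (inferInstance : TopologicalSpace (ProjTensor X Y)) ∈ projAdmissible X Y :=
  ⟨inferInstance, inferInstance, LocallyConvexSpace.sInf fun _ ht => ht.2.2.1,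
    continuous_sInf_rng.2 fun _ ht => ht.2.2.2⟩

instance (X : Type u) (Y : Type v)
    [AddCommGroup X] [Module ℂ X] [TopologicalSpace X]
    [AddCommGroup Y] [Module ℂ Y] [TopologicalSpace Y] : UniformSpace (ProjTensor X Y) :=
  IsTopologicalAddGroup.rightUniformSpace (ProjTensor X Y)

instance (X : Type u) (Y : Type v)
    [AddCommGroup X] [Module ℂ X] [TopologicalSpace X]
    [AddCommGroup Y] [Module ℂ Y] [TopologicalSpace Y] : IsUniformAddGroup (ProjTensor X Y) :=
  isUniformAddGroup_of_addCommGroup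

instance (X : Type u) (Y : Type v)
    [AddCommGroup X] [Module ℂ X] [TopologicalSpace X]
    [AddCommGroup Y] [Module ℂ Y] [TopologicalSpace Y] :
    UniformContinuousConstSMul ℂ (ProjTensor X Y) :=
  uniformContinuousConstSMul_of_continuousConstSMul ℂ (ProjTensor X Y)

/-- The completed projective tensor product. -/
abbrev CompletedProjTensor (X : Type u) (Y : Type v)
    [AddCommGroup X] [Module ℂ X] [TopologicalSpace X]
    [AddCommGroup Y] [Module ℂ Y] [TopologicalSpace Y] : Type (max u v) :=
  UniformSpace.Completion (ProjTensor X Y)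

/-! ### Approximation and nuclearity -/

/-- The classical approximation property: the identity is the limit of continuous linear maps of
finite rank, uniformly on totally bounded sets. -/
def HasApproximation (Y : Type v) [AddCommGroup Y] [Module ℂ Y] [UniformSpace Y] : Prop :=
  ∀ S : Set Y, TotallyBounded S → ∀ V ∈ 𝓝 (0 : Y),
    ∃ T : Y →L[ℂ] Y, FiniteDimensional ℂ (LinearMap.range (T : Y →ₗ[ℂ] Y)) ∧
      ∀ y ∈ S, T y - y ∈ V

/-- Nuclearity: for every continuous seminorm `p` there is a continuous seminorm `q ≥ p` such that
the canonical map from `(Y, q)/ker q` to `(Y, p)/ker p` is nuclear, that is, of the form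
`∑ₙ fₙ(·) yₙ` (converging pointwise with respect to `p`) with `∑ₙ ‖fₙ‖ p(yₙ) < ∞`, where `fₙ` are
`q`-bounded functionals and `c n` bounds the norm `‖fₙ‖` of `fₙ` relative to `q`. -/
def IsNuclear (Y : Type v) [AddCommGroup Y] [Module ℂ Y] [TopologicalSpace Y] : Prop :=
  ∀ p : Seminorm ℂ Y, Continuous p →
    ∃ q : Seminorm ℂ Y, Continuous q ∧ p ≤ q ∧
      ∃ (f : ℕ → Y →ₗ[ℂ] ℂ) (y : ℕ → Y) (c : ℕ → ℝ≥0),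
        (∀ n x, ‖f n x‖ ≤ c n * q x) ∧
        Summable (fun n => (c n : ℝ) * p (y n)) ∧
        ∀ x, Tendsto (fun N => p (x - ∑ n ∈ Finset.range N, f n x • y n)) atTop (𝓝 0)

end StereotypeTensor

end

open Topology Filter Set
open scoped TensorProduct UniformConvergence NNReal

noncomputable section

namespace StereotypeTensor

/-! ### Continuous seminorms and Hahn–Banach -/

section Seminorms

/-! A tensor `z` is read as the finite-rank operator `f ↦ (f ⊗ id) z` in `X · Y`. If this map `X ⊗ Y
→ X · Y` induces the topology of its source, has dense range, and `X · Y` is complete and Hausdorff,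
then `X · Y` is the completion (`exists_completion_equiv`).

Injective topology (`isUniformInducing_injMap`): by Hahn–Banach a continuous seminorm on `Y` is the
supremum over the polar of its unit ball.

Density (`denseRange_tensorMap`): polars `U°` are totally bounded in `X⋆`, so `φ(U°)` is totally
bounded and `T ∘ φ` approximates `φ` on `U°` for some `T` of finite rank. Functionals on `X⋆` are
evaluations (`exists_evalAt_eq`), so `T ∘ φ` is a tensor.

Completeness: a limit of operators, uniform on polars, sends polars to totally bounded sets and has
a transpose into `X`; these two properties force continuity
(`continuous_of_totallyBounded_of_transpose`).

Nuclear `Y`: expanding `z` along `∑ fₙ(·) yₙ` bounds each projective seminorm of `z` by `∑ cₙ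
p'(yₙ)` times an injective one (`seminorm_le_of_nuclear`), so `π` is induced from `X · Y` too. -/

theorem seminorm_closedBall_mem_nhds {X : Type*} [AddCommGroup X] [Module ℂ X]
    [TopologicalSpace X] (p : Seminorm ℂ X) (hp : Continuous p) {r : ℝ} (hr : 0 < r) :
    {x | p x ≤ r} ∈ 𝓝 (0 : X) := by
  have : ∀ᶠ x in 𝓝 (0 : X), p x < r := hp.continuousAt.eventually_lt_const (by simpa using hr)
  filter_upwards [this] with x hx using hx.le

variable {X : Type*} [AddCommGroup X] [Module ℂ X] [TopologicalSpace X] [IsTopologicalAddGroup X]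
  [ContinuousSMul ℂ X] [LocallyConvexSpace ℝ X]

-- In the order of `ℂ` the nonnegative scalars are the nonnegative reals, so real convexity is
-- complex convexity.
variable (X) in
open scoped ComplexOrder in
theorem polynormableSpace_of_locallyConvexSpace_real : PolynormableSpace ℂ X := by
  have : ContinuousSMul ℝ X := IsScalarTower.continuousSMul ℂ
  have : LocallyConvexSpace ℂ X := by
    refine LocallyConvexSpace.ofBasisZero ℂ X _ _
      (LocallyConvexSpace.convex_basis_zero ℝ X) fun s hs => ?_
    exact convex_of_nonneg_surjective_algebraMap _
        (fun _ h => RCLike.nonneg_iff_exists_ofReal.mp h) hs.2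
  infer_instance

/-- Every neighbourhood of zero contains the closed unit ball of a continuous seminorm. -/
theorem exists_continuous_seminorm {U : Set X} (hU : U ∈ 𝓝 (0 : X)) :
    ∃ p : Seminorm ℂ X, Continuous p ∧ ∀ x, p x ≤ 1 → x ∈ U := by
  have : PolynormableSpace ℂ X := polynormableSpace_of_locallyConvexSpace_real X
  have h := (PolynormableSpace.withSeminorms ℂ X).hasBasis_zero_ball
  obtain ⟨⟨s, r⟩, hr, hs⟩ := h.mem_iff.1 hU
  simp only at hr hs
  set q : Seminorm ℂ X := s.sup fun p : {p : Seminorm ℂ X // Continuous p} => p.1 with hq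
  have hc : Continuous q := Seminorm.continuous_finsetSup fun p _ => p.2
  refine ⟨(2 / r).toNNReal • q, hc.const_smul (2 / r).toNNReal, fun x hx => hs ?_⟩
  · rw [Seminorm.mem_ball_zero]
    have hx' : (2 / r).toNNReal * q x ≤ 1 := hx
    rw [Real.coe_toNNReal _ (by positivity)] at hx'
    have := mul_le_mul_of_nonneg_left hx' hr.le
    field_simp at this
    linarith

/-- Hahn–Banach: a continuous seminorm is attained by a functional which it dominates. -/
theorem exists_functional_eq_seminorm (p : Seminorm ℂ X) (hp : Continuous p) (x : X) :
    ∃ f : X →L[ℂ] ℂ, ‖f x‖ = p x ∧ ∀ y, ‖f y‖ ≤ p y := by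
  have : PolynormableSpace ℂ X := polynormableSpace_of_locallyConvexSpace_real X
  by_cases hx : x = 0
  · exact ⟨0, by simp [hx], by simp⟩
  let e := LinearEquiv.toSpanNonzeroSingleton ℂ X x hx
  let f : Module.Dual ℂ (Submodule.span ℂ {x}) := (p x : ℂ) • e.symm.toLinearMap
  obtain ⟨g, hg, hgp⟩ := Module.Dual.exists_continuous_extension_of_le_seminorm
    (Submodule.span ℂ {x}) f hp (by
      intro y
      obtain ⟨c, rfl⟩ := e.surjective y
      have : ((e c : Submodule.span ℂ {x}) : X) = c • x := rfl
      simp [f, this, map_smul_eq_mul, mul_comm, abs_of_nonneg (apply_nonneg p x)])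
  refine ⟨g, ?_, hgp⟩
  have h1 := hg (e 1)
  have h2 : ((e 1 : Submodule.span ℂ {x}) : X) = x := one_smul ℂ x
  rw [h2] at h1
  simp [h1, f, abs_of_nonneg (apply_nonneg p x)]

end Seminorms

/-! ### The stereotype dual and polars -/

section Dual

variable {X : Type*} [AddCommGroup X] [Module ℂ X] [UniformSpace X]

/-- A continuous functional as an element of the stereotype dual. -/
def toStarDual (f : X →L[ℂ] ℂ) : StarDual X := f

omit [AddCommGroup X] [Module ℂ X] in
theorem sUnion_totallyBounded : ⋃₀ {S : Set X | TotallyBounded S} = univ :=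
  eq_univ_of_forall fun x => ⟨{x}, totallyBounded_singleton x, rfl⟩

instance : ContinuousEvalConst (StarDual X) X ℂ :=
  UniformConvergenceCLM.continuousEvalConst _ _ _ sUnion_totallyBounded

/-- Evaluation at a point as a continuous functional on the stereotype dual. -/
def evalAt (x : X) : StarDual X →L[ℂ] ℂ where
  toFun f := f x
  map_add' _ _ := rfl
  map_smul' _ _ := rfl
  cont := continuous_eval_const x

@[simp]
theorem evalAt_apply (x : X) (f : StarDual X) : evalAt x f = f x := rfl

theorem setOf_norm_le_mem_nhds_starDual {S : Set X} (hS : TotallyBounded S) {ε : ℝ} (hε : 0 < ε) :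
    {f : StarDual X | ∀ x ∈ S, ‖f x‖ ≤ ε} ∈ 𝓝 (0 : StarDual X) := by
  filter_upwards [UniformConvergenceCLM.eventually_nhds_zero_mapsTo (RingHom.id ℂ)
    (show S ∈ {S : Set X | TotallyBounded S} from hS)
    (Metric.closedBall_mem_nhds (0 : ℂ) hε)] with f hf x hx
  simpa using hf hx

theorem exists_totallyBounded_of_mem_nhds_starDual [IsUniformAddGroup X] [ContinuousSMul ℂ X]
    {W : Set (StarDual X)} (hW : W ∈ 𝓝 (0 : StarDual X)) :
    ∃ S : Set X, TotallyBounded S ∧ ∀ f : StarDual X, (∀ x ∈ S, ‖f x‖ ≤ 1) → f ∈ W := by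
  obtain ⟨⟨S, ε⟩, ⟨hS, hε⟩, hSW⟩ := (UniformConvergenceCLM.hasBasis_nhds_zero_of_basis
    (RingHom.id ℂ) ℂ {S : Set X | TotallyBounded S} ⟨∅, totallyBounded_empty⟩
    (directedOn_of_sup_mem fun _ _ => TotallyBounded.union)
    (Metric.nhds_basis_closedBall (x := (0 : ℂ)))).mem_iff.1 hW
  simp only at hS hε hSW
  have : UniformContinuousConstSMul ℂ X := uniformContinuousConstSMul_of_continuousConstSMul ℂ X
  -- The radius `ε` is absorbed into the totally bounded set.
  refine ⟨(fun x => ((ε⁻¹ : ℝ) : ℂ) • x) '' S,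
    hS.image (uniformContinuous_const_smul _), fun f hf => hSW fun x hx => ?_⟩
  have := hf _ (mem_image_of_mem _ hx)
  rw [map_smul, norm_smul, Complex.norm_real, Real.norm_of_nonneg (by positivity)] at this
  rw [mem_closedBall_zero_iff]
  field_simp at this
  simpa using this

theorem nhdsPolars_nonempty : (nhdsPolars X).Nonempty := ⟨_, univ, univ_mem, rfl⟩

theorem polarSet_mono {A B : Set X} (h : A ⊆ B) : polarSet B ⊆ polarSet A :=
  fun _ hf x hx => hf x (h hx)

theorem polarSet_mem_nhdsPolars {U : Set X} (hU : U ∈ 𝓝 (0 : X)) : polarSet U ∈ nhdsPolars X :=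
  ⟨U, hU, rfl⟩

theorem directedOn_nhdsPolars : DirectedOn (· ⊆ ·) (nhdsPolars X) := by
  rintro _ ⟨U, hU, rfl⟩ _ ⟨V, hV, rfl⟩
  exact ⟨_, polarSet_mem_nhdsPolars (inter_mem hU hV), polarSet_mono inter_subset_left,
    polarSet_mono inter_subset_right⟩

/-- Every functional lies in the polar of a neighbourhood of zero. -/
theorem exists_mem_polarSet (f : StarDual X) : ∃ U ∈ 𝓝 (0 : X), f ∈ polarSet U := by
  have : ∀ᶠ x in 𝓝 (0 : X), ‖f x‖ < 1 :=
    (map_continuous f).norm.continuousAt.eventually_lt_const (by simp)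
  exact ⟨_, this, fun x hx => le_of_lt hx⟩

theorem sUnion_nhdsPolars : ⋃₀ nhdsPolars X = univ :=
  eq_univ_of_forall fun f =>
    let ⟨_, hU, hf⟩ := exists_mem_polarSet f
    ⟨_, polarSet_mem_nhdsPolars hU, hf⟩

/-- Functionals in the polar of the unit ball of a seminorm are dominated by the seminorm. -/
theorem norm_le_of_mem_polarSet_closedBall {p : Seminorm ℂ X} {f : StarDual X}
    (hf : f ∈ polarSet {x | p x ≤ 1}) (x : X) : ‖f x‖ ≤ p x := by
  have key : ∀ r : ℝ, 0 < r → p x ≤ r → ‖f x‖ ≤ r := by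
    intro r hr hx
    have h := hf (((r⁻¹ : ℝ) : ℂ) • x) (by
      rw [mem_ofPred_eq, map_smul_eq_mul, Complex.norm_real, Real.norm_of_nonneg (by positivity)]
      rwa [inv_mul_le_iff₀ hr, mul_one])
    rw [map_smul, norm_smul, Complex.norm_real, Real.norm_of_nonneg (by positivity),
      inv_mul_le_iff₀ hr, mul_one] at h
    exact h
  refine le_of_forall_pos_le_add fun ε hε => ?_
  exact key _ (add_pos_of_nonneg_of_pos (apply_nonneg p x) hε) (by linarith)

/-! ### Total boundedness of polars; functionals on the dual -/

section LocallyConvex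

variable [IsUniformAddGroup X] [ContinuousSMul ℂ X] [LocallyConvexSpace ℝ X]

/-- Polars of neighbourhoods of zero are totally bounded in the stereotype dual. -/
theorem totallyBounded_polarSet {U : Set X} (hU : U ∈ 𝓝 (0 : X)) :
    TotallyBounded (polarSet U) := by
  obtain ⟨p, hp, hpU⟩ := exists_continuous_seminorm hU
  have hfp : ∀ f ∈ polarSet U, ∀ x, ‖f x‖ ≤ p x := fun f hf =>
    norm_le_of_mem_polarSet_closedBall (polarSet_mono hpU hf)
  rw [totallyBounded_iff_subset_finite_iUnion_nhds_zero]
  intro W hW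
  obtain ⟨S, hS, hSW⟩ := exists_totallyBounded_of_mem_nhds_starDual hW
  obtain ⟨F, hF, hSF⟩ := totallyBounded_iff_subset_finite_iUnion_nhds_zero.1 hS _
    (seminorm_closedBall_mem_nhds p hp (show (0 : ℝ) < 3⁻¹ by norm_num))
  have : Fintype F := hF.fintype
  -- Restriction to `F` sends the polar into a compact box. Functionals within `1/3` of each other
  -- on `F` differ by at most `1/3 + 1/3 + 1/3` on `S ⊆ F + {p ≤ 1/3}`.
  let r : StarDual X → F → ℂ := fun f a => f a
  have hr : TotallyBounded (r '' polarSet U) := by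
    refine (isCompact_univ_pi fun a : F =>
      isCompact_closedBall (0 : ℂ) (p a)).totallyBounded.subset ?_
    rintro _ ⟨f, hf, rfl⟩ a -
    simpa using hfp f hf a
  obtain ⟨t, ht, htf, hcov⟩ := totallyBounded_iff_subset.1 hr _
    (Metric.dist_mem_uniformity (show (0 : ℝ) < 3⁻¹ by norm_num))
  obtain ⟨t', ht', htf', rfl⟩ := htf.exists_subset_finite_image_eq ht
  refine ⟨t', htf', fun f hf => ?_⟩
  have h1 := hcov (mem_image_of_mem r hf)
  simp only [mem_iUnion, exists_prop, mem_image, exists_exists_and_eq_and] at h1 ⊢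
  obtain ⟨g, hg, hfg⟩ := h1
  refine ⟨g, hg, ?_⟩
  rw [mem_vadd_set_iff_neg_vadd_mem]
  refine hSW _ fun x hx => ?_
  have h2 := hSF hx
  simp only [mem_iUnion, exists_prop] at h2
  obtain ⟨a, ha, u, hu, rfl⟩ := h2
  have h3 : ‖f a - g a‖ ≤ 3⁻¹ := by
    rw [← dist_eq_norm]
    exact (dist_le_pi_dist (r f) (r g) ⟨a, ha⟩).trans hfg.le
  have h4 := (hfp f hf u).trans hu
  have h5 := (hfp g (ht' hg) u).trans hu
  have : (-g +ᵥ f) (a +ᵥ u) = (f a - g a) + f u - g u := by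
    change -(g (a + u)) + f (a + u) = _
    rw [map_add, map_add]
    ring
  rw [this]
  refine (norm_sub_le _ _).trans ?_
  have := norm_add_le (f a - g a) (f u)
  linarith

variable {Y : Type*} [AddCommGroup Y] [Module ℂ Y] [UniformSpace Y] [IsUniformAddGroup Y]
  [ContinuousSMul ℂ Y]

instance [T2Space Y] : T2Space (PrimaryTensor X Y) :=
  UniformConvergenceCLM.t2Space _ _ _ sUnion_nhdsPolars

instance : ContinuousSMul ℂ (PrimaryTensor X Y) := by
  have : ContinuousSMul ℂ (StarDual X) := UniformConvergenceCLM.continuousSMul _ _ _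
    fun S hS => hS.isVonNBounded ℂ
  refine UniformConvergenceCLM.continuousSMul _ _ _ ?_
  rintro _ ⟨U, hU, rfl⟩
  exact (totallyBounded_polarSet hU).isVonNBounded ℂ

instance [LocallyConvexSpace ℝ Y] : LocallyConvexSpace ℝ (PrimaryTensor X Y) :=
  have : ContinuousSMul ℝ Y := IsScalarTower.continuousSMul ℂ
  UniformConvergenceCLM.locallyConvexSpace ℝ _ nhdsPolars_nonempty directedOn_nhdsPolars

omit [ContinuousSMul ℂ Y] in
theorem totallyBounded_image_polarSet (φ : StarDual X →L[ℂ] Y) {U : Set X} (hU : U ∈ 𝓝 (0 : X)) :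
    TotallyBounded (φ '' polarSet U) :=
  (totallyBounded_polarSet hU).image φ.uniformContinuous

/-- The value of a continuous seminorm is bounded by the functionals in the polar of its closed unit
ball. -/
theorem seminorm_le_of_forall_mem_polarSet {p : Seminorm ℂ X} (hp : Continuous p) {M : ℝ} {x : X}
    (h : ∀ f ∈ polarSet {x | p x ≤ 1}, ‖f x‖ ≤ M) : p x ≤ M := by
  obtain ⟨f, hfx, hf⟩ := exists_functional_eq_seminorm p hp x
  rw [← hfx]
  exact h (toStarDual f) fun y hy => (hf y).trans hy

/-- A form of the Mackey–Arens theorem: every continuous functional on the stereotype dual of a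
complete space is the evaluation at a point. -/
theorem exists_evalAt_eq [CompleteSpace X] (g : StarDual X →L[ℂ] ℂ) :
    ∃ x : X, evalAt x = g := by
  have : ContinuousSMul ℝ X := IsScalarTower.continuousSMul ℂ
  have : UniformContinuousConstSMul ℂ X := uniformContinuousConstSMul_of_continuousConstSMul ℂ X
  obtain ⟨S, hS, hSg⟩ := exists_totallyBounded_of_mem_nhds_starDual
    (W := {f | ‖g f‖ < 1})
    ((map_continuous g).norm.continuousAt.eventually_lt_const (by simp))
  -- The factors `2` and `2i` turn `Re f ≤ 1` on the real absolutely convex hull into `|Re f|, |Im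
  -- f| ≤ 1/2` on `S`. The point `0` makes the separating constant `s` below positive.
  let S' : Set X := insert 0 ((fun x => (2 : ℂ) • x) '' S ∪ (fun x => (2 * Complex.I) • x) '' S)
  have hS' : TotallyBounded S' := ((hS.image (uniformContinuous_const_smul _)).union
    (hS.image (uniformContinuous_const_smul _))).insert 0
  let K : Set X := closure (absConvexHull ℝ S')
  have hK : IsCompact K :=
    hS'.absConvexHull.closure.isCompact_of_isClosed isClosed_closure
  have hKc : Convex ℝ K := (convex_absConvexHull).closure
  have hSK : S' ⊆ K := subset_absConvexHull.trans subset_closure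
  have hKneg : ∀ x ∈ S', -x ∈ K := fun x hx => subset_closure <|
    (balanced_absConvexHull.neg_mem_iff).2 (subset_absConvexHull hx)
  -- a functional whose real part is at most one on `K` is at most one on `S`
  have hbound : ∀ f : StarDual X, (∀ x ∈ K, (f x).re ≤ 1) → ‖g f‖ < 1 := by
    intro f hf
    refine hSg f fun x hx => ?_
    have h1 : (2 : ℂ) • x ∈ S' := mem_insert_of_mem _ (Or.inl ⟨x, hx, rfl⟩)
    have h2 : (2 * Complex.I) • x ∈ S' := mem_insert_of_mem _ (Or.inr ⟨x, hx, rfl⟩)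
    have a1 := hf _ (hSK h1)
    have a2 := hf _ (hKneg _ h1)
    have a3 := hf _ (hSK h2)
    have a4 := hf _ (hKneg _ h2)
    simp only [map_neg, map_smul, smul_eq_mul, Complex.neg_re, Complex.mul_re, Complex.mul_im,
      Complex.re_ofNat, Complex.im_ofNat, Complex.I_re, Complex.I_im] at a1 a2 a3 a4
    refine (Complex.norm_le_abs_re_add_abs_im _).trans ?_
    have : |(f x).re| ≤ 1 / 2 := abs_le.2 ⟨by linarith, by linarith⟩
    have : |(f x).im| ≤ 1 / 2 := abs_le.2 ⟨by linarith, by linarith⟩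
    linarith
  -- By compactness of `K` it is enough to solve finitely many equations `f x = g f`. If `(g f)` lay
  -- outside the compact convex set `L '' K`, a separating functional would give a combination `f₀`
  -- with `Re f₀ < s` on `K` but `s < Re (g f₀)`, whereas `hbound` for `s⁻¹ f₀` gives `‖g f₀‖ < s`.
  have hfin : ∀ u : Finset (StarDual X), (K ∩ ⋂ f ∈ u, {x | f x = g f}).Nonempty := by
    intro u
    let L : X →L[ℂ] (u → ℂ) := ContinuousLinearMap.pi fun f : u => (UniformConvergenceCLM.ofFun _ _ _).symm f.1
    suffices h : (fun f : u => g f) ∈ L '' K by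
      obtain ⟨x, hx, hLx⟩ := h
      refine ⟨x, hx, mem_iInter₂.2 fun f hf => ?_⟩
      exact (congrFun hLx ⟨f, hf⟩ :)
    by_contra hcon
    obtain ⟨φ, s, hφ, hs⟩ := RCLike.geometric_hahn_banach_closed_point (𝕜 := ℂ)
      (hKc.linear_image (L.toLinearMap.restrictScalars ℝ)) (hK.image L.continuous).isClosed hcon
    classical
    let f₀ : StarDual X := ∑ f : u, φ (Pi.single f 1) • (f : StarDual X)
    have hφL : ∀ v : u → ℂ, φ v = ∑ f : u, φ (Pi.single f 1) * v f := by
      intro v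
      conv_lhs => rw [pi_eq_sum_univ' v]
      simp [mul_comm]
    have hf₀ : ∀ x, φ (L x) = f₀ x := by
      intro x
      rw [hφL, ← evalAt_apply x f₀]
      simp [f₀, L]
      rfl
    have hgf₀ : φ (fun f : u => g f) = g f₀ := by
      rw [hφL]
      simp [f₀]
    have h0 : 0 < s := by
      have := hφ 0 ⟨0, hSK (mem_insert _ _), map_zero L⟩
      simpa using this
    have h1 := hbound (((s⁻¹ : ℝ) : ℂ) • f₀) fun x hx => by
      have h2 := hφ _ (mem_image_of_mem L hx)
      rw [hf₀] at h2
      have h3 : (((s⁻¹ : ℝ) : ℂ) • f₀) x = ((s⁻¹ : ℝ) : ℂ) * f₀ x := rfl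
      rw [h3, Complex.re_ofReal_mul, inv_mul_le_iff₀ h0, mul_one]
      exact h2.le
    rw [map_smul, norm_smul, Complex.norm_real, Real.norm_of_nonneg (by positivity),
      inv_mul_lt_iff₀ h0, mul_one] at h1
    rw [hgf₀] at hs
    exact absurd ((hs.trans_le (Complex.re_le_norm _)).trans h1) (lt_irrefl _)
  obtain ⟨x, -, hx⟩ := hK.inter_iInter_nonempty (fun f : StarDual X => {x | f x = g f})
    (fun f => isClosed_eq (map_continuous f) continuous_const) hfin
  exact ⟨x, ContinuousLinearMap.ext fun f => mem_iInter.1 hx f⟩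

end LocallyConvex

end Dual

/-! ### Completeness of the primary tensor product -/

section Completeness

variable {X : Type*} [AddCommGroup X] [Module ℂ X] [UniformSpace X] [IsUniformAddGroup X]
  [ContinuousSMul ℂ X] [LocallyConvexSpace ℝ X]
  {Y : Type*} [AddCommGroup Y] [Module ℂ Y] [UniformSpace Y] [IsUniformAddGroup Y]

omit [Module ℂ Y] in
/-- A uniform limit of maps with totally bounded image of a set has totally bounded image. -/
theorem totallyBounded_image_of_tendstoUniformlyOn {ι α : Type*} {F : Filter ι} [F.NeBot]
    {ψ : ι → α → Y} {φ : α → Y} {s : Set α} (h : TendstoUniformlyOn ψ φ F s)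
    (hψ : ∀ i, TotallyBounded (ψ i '' s)) : TotallyBounded (φ '' s) := by
  rw [totallyBounded_iff_subset_finite_iUnion_nhds_zero]
  intro V hV
  obtain ⟨V', hV', hVV⟩ := exists_nhds_zero_half hV
  have h1 := h {p | p.1 - p.2 ∈ V'} (by
    rw [uniformity_eq_comap_nhds_zero_swapped]
    exact ⟨V', hV', fun p hp => hp⟩)
  obtain ⟨i, hi⟩ := h1.exists
  obtain ⟨t, ht, hcov⟩ := totallyBounded_iff_subset_finite_iUnion_nhds_zero.1 (hψ i) V' hV'
  refine ⟨t, ht, ?_⟩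
  rintro _ ⟨a, ha, rfl⟩
  have h2 := hcov (mem_image_of_mem _ ha)
  simp only [mem_iUnion, exists_prop] at h2 ⊢
  obtain ⟨y, hy, v, hv, hyv⟩ := h2
  refine ⟨y, hy, v + (φ a - ψ i a), hVV _ hv _ (hi a ha), ?_⟩
  simp only [vadd_eq_add] at hyv ⊢
  rw [← add_assoc, hyv]
  abel

/-- If `φ` is a limit of continuous linear maps on `X⋆`, uniformly on polars of neighbourhoods of
zero, then its composition with a functional is the evaluation at a point. -/
theorem exists_apply_eq_of_tendstoUniformlyOn [CompleteSpace X]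
    {F : Filter (PrimaryTensor X Y)} [F.NeBot] {φ : StarDual X → Y}
    (h : ∀ U ∈ 𝓝 (0 : X), TendstoUniformlyOn (fun (ψ : PrimaryTensor X Y) f => ψ f) φ F
      (polarSet U)) (g : Y →L[ℂ] ℂ) :
    ∃ x : X, ∀ f : StarDual X, f x = g (φ f) := by
  have he : ∀ ψ : PrimaryTensor X Y, ∃ x : X, ∀ f : StarDual X, f x = g (ψ f) := fun ψ => by
    obtain ⟨x, hx⟩ := exists_evalAt_eq
      (g.comp ((UniformConvergenceCLM.ofFun (RingHom.id ℂ) Y (nhdsPolars X)).symm ψ))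
    exact ⟨x, fun f => congrArg (fun k : StarDual X →L[ℂ] ℂ => k f) hx⟩
  choose e he using he
  have hg : ∀ U ∈ 𝓝 (0 : X), ∀ ε > 0, ∀ᶠ ψ in F, ∀ f ∈ polarSet U, ‖g (φ f) - f (e ψ)‖ < ε := by
    intro U hU ε hε
    have h1 := (g.uniformContinuous.comp_tendstoUniformlyOn (h U hU)) _
      (Metric.dist_mem_uniformity hε)
    filter_upwards [h1] with ψ hψ f hf
    rw [he, ← dist_eq_norm]
    exact hψ f hf
  -- The polar of the `p`-ball norms `p`, so uniform closeness on it of the functionals `g ∘ ψ` is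
  -- `p`-closeness of the points `e ψ`.
  have hcauchy : Cauchy (F.map e) := by
    rw [cauchy_map_iff]
    refine ⟨inferInstance, ?_⟩
    rw [uniformity_eq_comap_nhds_zero, tendsto_comap_iff]
    intro U hU
    obtain ⟨p, hp, hpU⟩ := exists_continuous_seminorm hU
    have h1 := hg _ (seminorm_closedBall_mem_nhds p hp one_pos) (1 / 2) (by norm_num)
    rw [mem_map]
    filter_upwards [h1.prod_mk h1] with q hq
    refine hpU _ (seminorm_le_of_forall_mem_polarSet hp fun f hf => ?_)
    have a1 := hq.1 f hf
    have a2 := hq.2 f hf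
    have : f (e q.2 - e q.1) = (g (φ f) - f (e q.1)) - (g (φ f) - f (e q.2)) := by
      rw [map_sub]; ring
    simp only [Function.comp]
    rw [this]
    exact (norm_sub_le _ _).trans (by linarith)
  obtain ⟨x, hx⟩ := CompleteSpace.complete hcauchy
  refine ⟨x, fun f => ?_⟩
  have h1 : Tendsto (fun ψ => f (e ψ)) F (𝓝 (f x)) :=
    ((map_continuous f).tendsto x).comp hx
  have h2 : Tendsto (fun ψ => f (e ψ)) F (𝓝 (g (φ f))) := by
    obtain ⟨U, hU, hf⟩ := exists_mem_polarSet f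
    rw [Metric.tendsto_nhds]
    intro ε hε
    filter_upwards [hg U hU ε hε] with ψ hψ
    rw [dist_eq_norm, norm_sub_rev]
    exact hψ f hf
  exact tendsto_nhds_unique h1 h2

variable [ContinuousSMul ℂ Y] [LocallyConvexSpace ℝ Y]

/-- A linear map `φ : X⋆ → Y` is continuous as soon as it maps polars of neighbourhoods of zero to
totally bounded sets and has a transpose with values in `X`. -/
theorem continuous_of_totallyBounded_of_transpose (φ : StarDual X →ₗ[ℂ] Y)
    (hφ : ∀ U ∈ 𝓝 (0 : X), TotallyBounded (φ '' polarSet U))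
    (htr : ∀ g : Y →L[ℂ] ℂ, ∃ x : X, ∀ f : StarDual X, f x = g (φ f)) : Continuous φ := by
  refine continuous_of_tendsto_nhds_zero φ ?_
  intro V hV
  obtain ⟨q, hq, hqV⟩ := exists_continuous_seminorm hV
  let B : Set (StarDual Y) := polarSet {y | q y ≤ 1}
  have hB : TotallyBounded B := totallyBounded_polarSet (seminorm_closedBall_mem_nhds q hq one_pos)
  have htr' : ∀ g : StarDual Y, ∃ x : X, ∀ f : StarDual X, f x = g (φ f) := fun g =>
    htr ((UniformConvergenceCLM.ofFun _ _ _).symm g)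
  choose e he using htr'
  -- The transpose carries uniform closeness on `φ(U°)` to closeness in `X`, and `B` is totally
  -- bounded in `Y⋆`. Functionals at most one on `e '' B` then form a neighbourhood of zero in `X⋆`
  -- on which `q ∘ φ ≤ 1`.
  have heB : TotallyBounded (e '' B) := by
    rw [totallyBounded_iff_subset_finite_iUnion_nhds_zero]
    intro U hU
    obtain ⟨p, hp, hpU⟩ := exists_continuous_seminorm hU
    have hW := setOf_norm_le_mem_nhds_starDual
      (hφ _ (seminorm_closedBall_mem_nhds p hp one_pos)) one_pos
    obtain ⟨t, ht, hcov⟩ := totallyBounded_iff_subset_finite_iUnion_nhds_zero.1 hB _ hW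
    refine ⟨e '' t, ht.image e, ?_⟩
    rintro _ ⟨b, hb, rfl⟩
    have h1 := hcov hb
    simp only [mem_iUnion, exists_prop, mem_image, exists_exists_and_eq_and] at h1 ⊢
    obtain ⟨g, hg, w, hw, rfl⟩ := h1
    refine ⟨g, hg, e (g +ᵥ w) - e g, hpU _ (seminorm_le_of_forall_mem_polarSet hp fun f hf => ?_),
      by simp⟩
    rw [map_sub, he, he]
    have : (g +ᵥ w) (φ f) = g (φ f) + w (φ f) := rfl
    rw [this, add_sub_cancel_left]
    exact hw _ (mem_image_of_mem _ hf)
  rw [mem_map]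
  filter_upwards [setOf_norm_le_mem_nhds_starDual heB one_pos] with f hf
  refine hqV _ (seminorm_le_of_forall_mem_polarSet hq fun g hg => ?_)
  rw [← he]
  exact hf _ (mem_image_of_mem _ hg)

/-- Uniform convergence on polars does not make the limit continuous by itself, since polars need
not be neighbourhoods in `X⋆`; total boundedness of images and the transpose supply continuity. -/
instance [CompleteSpace X] [T2Space Y] [CompleteSpace Y] :
    CompleteSpace (PrimaryTensor X Y) := by
  refine ⟨fun {F} hF => ?_⟩
  have : F.NeBot := hF.1
  let c := UniformConvergenceCLM.isUniformInducing_coeFn (RingHom.id ℂ) Y (nhdsPolars X)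
  obtain ⟨φ, hφ⟩ := CompleteSpace.complete (hF.map c.uniformContinuous)
  have hφ' : Tendsto _ F (𝓝 φ) := hφ
  have hunif := UniformOnFun.tendsto_iff_tendstoUniformlyOn.1 hφ'
  have hU : ∀ U ∈ 𝓝 (0 : X), TendstoUniformlyOn (fun (ψ : PrimaryTensor X Y) f => ψ f)
    (UniformOnFun.toFun _ φ) F (polarSet U) := fun U hU => hunif _ (polarSet_mem_nhdsPolars hU)
  have hpt : ∀ f, Tendsto (fun ψ : PrimaryTensor X Y => ψ f) F (𝓝 (UniformOnFun.toFun _ φ f)) := by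
    intro f
    obtain ⟨U, h, hf⟩ := exists_mem_polarSet f
    exact (hU U h).tendsto_at hf
  let φl : StarDual X →ₗ[ℂ] Y :=
    { toFun := UniformOnFun.toFun _ φ
      map_add' := fun f g => tendsto_nhds_unique (hpt (f + g))
        (((hpt f).add (hpt g)).congr fun ψ => (map_add ψ f g).symm)
      map_smul' := fun a f => tendsto_nhds_unique (hpt (a • f))
        (((hpt f).const_smul a).congr fun ψ => (map_smul ψ a f).symm) }
  have hcont : Continuous φl := continuous_of_totallyBounded_of_transpose φl
    (fun U h => totallyBounded_image_of_tendstoUniformlyOn (hU U h) fun ψ =>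
      totallyBounded_image_polarSet ((UniformConvergenceCLM.ofFun _ _ _).symm ψ) h)
    (fun g => exists_apply_eq_of_tendstoUniformlyOn hU g)
  refine ⟨UniformConvergenceCLM.ofFun _ _ _ ⟨φl, hcont⟩, ?_⟩
  rw [c.isInducing.nhds_eq_comap, ← map_le_iff_le_comap]
  exact hφ

end Completeness

/-! ### Tensors as finite-rank operators; density -/

section TensorMap

variable {X : Type*} [AddCommGroup X] [Module ℂ X] [UniformSpace X]
  {Y : Type*} [AddCommGroup Y] [Module ℂ Y] [UniformSpace Y] [IsUniformAddGroup Y]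
  [ContinuousSMul ℂ Y]

/-- The operator `f ↦ f x • y` as an element of the primary tensor product. -/
def rankOne (x : X) (y : Y) : PrimaryTensor X Y :=
  UniformConvergenceCLM.ofFun _ _ _ ((evalAt x).smulRight y)

omit [IsUniformAddGroup Y] in
@[simp]
theorem rankOne_apply (x : X) (y : Y) (f : StarDual X) : rankOne x y f = f x • y := rfl

variable (X Y) in
/-- The canonical map from the algebraic to the primary tensor product. -/
def tensorMap : X ⊗[ℂ] Y →ₗ[ℂ] PrimaryTensor X Y :=
  TensorProduct.lift (LinearMap.mk₂ ℂ rankOne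
    (fun x x' y => UniformConvergenceCLM.ext _ _ fun f => by
      change f (x + x') • y = f x • y + f x' • y
      rw [map_add, add_smul])
    (fun c x y => UniformConvergenceCLM.ext _ _ fun f => by
      change f (c • x) • y = c • f x • y
      rw [map_smul, smul_assoc])
    (fun x y y' => UniformConvergenceCLM.ext _ _ fun f => smul_add (f x) y y')
    (fun c x y => UniformConvergenceCLM.ext _ _ fun f => smul_comm (f x) c y))

@[simp]
theorem tensorMap_tmul (x : X) (y : Y) : tensorMap X Y (x ⊗ₜ y) = rankOne x y := rfl

theorem pairing_eq (f : StarDual X) (g : Y →ₗ[ℂ] ℂ) (z : X ⊗[ℂ] Y) :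
    pairing (f : X →ₗ[ℂ] ℂ) g z = g (tensorMap X Y z f) := by
  induction z with
  | zero => simp
  | tmul x y => simp [pairing]
  | add z w hz hw => rw [map_add, hz, hw, map_add, add_apply, map_add]

section Injective

variable [IsUniformAddGroup X] [ContinuousSMul ℂ X]

omit [IsUniformAddGroup X] [ContinuousSMul ℂ X] in
theorem hasBasis_nhds_zero_injTensor :
    (𝓝 (0 : InjTensor X Y)).HasBasis
      (fun i : (Set X × Set Y) × ℝ => (i.1.1 ∈ 𝓝 0 ∧ i.1.2 ∈ 𝓝 0) ∧ 0 < i.2)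
      fun i => {z | ∀ f ∈ polarSet i.1.1, ∀ g ∈ polarSet i.1.2,
        ‖(g : StarDual Y) (tensorMap X Y z f)‖ ≤ i.2} := by
  have hne : (polarRectangles X Y).Nonempty := ⟨_, univ, univ_mem, univ, univ_mem, rfl⟩
  have hdir : DirectedOn (· ⊆ ·) (polarRectangles X Y) := by
    rintro _ ⟨U, hU, V, hV, rfl⟩ _ ⟨U', hU', V', hV', rfl⟩
    exact ⟨_, ⟨_, inter_mem hU hU', _, inter_mem hV hV', rfl⟩,
      prod_mono (polarSet_mono inter_subset_left) (polarSet_mono inter_subset_left),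
      prod_mono (polarSet_mono inter_subset_right) (polarSet_mono inter_subset_right)⟩
  have h := (UniformOnFun.hasBasis_nhds_zero_of_basis _ hne hdir
    (Metric.nhds_basis_closedBall (x := (0 : ℂ)))).comap (InjTensor.toFun X Y)
  have hind : IsUniformInducing (InjTensor.toFun X Y) := ⟨rfl⟩
  rw [← map_zero (InjTensor.toFun X Y), ← hind.isInducing.nhds_eq_comap] at h
  refine h.to_hasBasis ?_ ?_
  · rintro ⟨_, ε⟩ ⟨⟨U, hU, V, hV, rfl⟩, hε⟩
    refine ⟨((U, V), ε), ⟨⟨hU, hV⟩, hε⟩, ?_⟩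
    rintro z hz ⟨f, g⟩ ⟨hf, hg⟩
    rw [mem_closedBall_zero_iff]
    exact (congrArg norm (pairing_eq f (g : Y →ₗ[ℂ] ℂ) z)).le.trans (hz f hf g hg)
  · rintro ⟨⟨U, V⟩, ε⟩ ⟨⟨hU, hV⟩, hε⟩
    refine ⟨(_, ε), ⟨⟨U, hU, V, hV, rfl⟩, hε⟩, ?_⟩
    intro z hz f hf g hg
    have h1 := mem_closedBall_zero_iff.1 (hz (f, g) ⟨hf, hg⟩)
    exact (congrArg norm (pairing_eq f (g : Y →ₗ[ℂ] ℂ) z)).ge.trans h1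

omit [ContinuousSMul ℂ Y] [IsUniformAddGroup X] [ContinuousSMul ℂ X] in
theorem hasBasis_nhds_zero_primaryTensor :
    (𝓝 (0 : PrimaryTensor X Y)).HasBasis (fun i : Set X × Set Y => i.1 ∈ 𝓝 0 ∧ i.2 ∈ 𝓝 0)
      fun i => {φ | ∀ f ∈ polarSet i.1, φ f ∈ i.2} := by
  refine (UniformConvergenceCLM.hasBasis_nhds_zero (RingHom.id ℂ) Y (nhdsPolars X)
    nhdsPolars_nonempty directedOn_nhdsPolars).to_hasBasis ?_ ?_
  · rintro ⟨_, V⟩ ⟨⟨U, hU, rfl⟩, hV⟩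
    exact ⟨(U, V), ⟨hU, hV⟩, subset_rfl⟩
  · rintro ⟨U, V⟩ ⟨hU, hV⟩
    exact ⟨(_, V), ⟨polarSet_mem_nhdsPolars hU, hV⟩, subset_rfl⟩

variable (X Y) in
/-- The canonical map, with the injective topology on its source. -/
def injMap : InjTensor X Y →ₗ[ℂ] PrimaryTensor X Y := tensorMap X Y

-- With `V` the unit ball of a seminorm `q`, the supremum of `|g (z f)|` over `g ∈ V°` is `q (z f)`,
-- so both topologies have the same neighbourhoods of zero.
omit [IsUniformAddGroup X] [ContinuousSMul ℂ X] in
theorem isUniformInducing_injMap [LocallyConvexSpace ℝ Y] :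
    IsUniformInducing (injMap X Y) := by
  refine AddMonoidHom.isUniformInducing_of_isInducing (f := injMap X Y) ?_
  rw [IsTopologicalAddGroup.isInducing_iff_nhds_zero]
  refine le_antisymm ?_ ?_
  · rw [← Filter.map_le_iff_le_comap]
    change Tendsto _ _ _
    rw [hasBasis_nhds_zero_injTensor.tendsto_iff hasBasis_nhds_zero_primaryTensor]
    rintro ⟨U, V⟩ ⟨hU, hV⟩
    obtain ⟨q, hq, hqV⟩ := exists_continuous_seminorm hV
    refine ⟨((U, {y | q y ≤ 1}), 1), ⟨⟨hU, seminorm_closedBall_mem_nhds q hq one_pos⟩, one_pos⟩, ?_⟩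
    intro z hz f hf
    exact hqV _ (seminorm_le_of_forall_mem_polarSet hq fun g hg => hz f hf g hg)
  · rw [(hasBasis_nhds_zero_primaryTensor.comap (injMap X Y)).le_basis_iff
      hasBasis_nhds_zero_injTensor]
    rintro ⟨⟨U, V⟩, ε⟩ ⟨⟨hU, hV⟩, hε⟩
    obtain ⟨q, hq, hqV⟩ := exists_continuous_seminorm hV
    refine ⟨(U, {y | q y ≤ ε}), ⟨hU, seminorm_closedBall_mem_nhds q hq hε⟩, ?_⟩
    intro z hz f hf g hg
    exact (norm_le_of_mem_polarSet_closedBall (polarSet_mono hqV hg) _).trans (hz f hf)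

end Injective

/-- Operators of finite rank come from the algebraic tensor product. -/
theorem comp_mem_range_tensorMap [IsUniformAddGroup X] [ContinuousSMul ℂ X]
    [LocallyConvexSpace ℝ X] [CompleteSpace X] [T2Space Y]
    (φ : StarDual X →L[ℂ] Y) (T : Y →L[ℂ] Y)
    (hT : FiniteDimensional ℂ (LinearMap.range (T : Y →ₗ[ℂ] Y))) :
    ∃ z, ∀ f, tensorMap X Y z f = T (φ f) := by
  let R := LinearMap.range (T : Y →ₗ[ℂ] Y)
  let b := Module.finBasis ℂ R
  let T' : Y →L[ℂ] R := T.codRestrict R fun y => ⟨y, rfl⟩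
  -- The coordinates of `T ∘ φ` in a basis of the range of `T` are functionals on `X⋆`, hence
  -- evaluations at points of `X`.
  have hx : ∀ i, ∃ x : X, evalAt x = ((b.coord i).toContinuousLinearMap.comp T').comp φ :=
    fun i => exists_evalAt_eq _
  choose x hx using hx
  refine ⟨∑ i, x i ⊗ₜ (b i : Y), fun f => ?_⟩
  have h1 : ∀ i, f (x i) = b.repr (T' (φ f)) i := fun i =>
    congrArg (fun k : StarDual X →L[ℂ] ℂ => k f) (hx i)
  have h2 := congrArg R.subtype (b.sum_repr (T' (φ f)))
  rw [map_sum] at h2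
  rw [map_sum, sum_apply]
  simp only [tensorMap_tmul, rankOne_apply, h1]
  exact h2

theorem denseRange_tensorMap [IsUniformAddGroup X] [ContinuousSMul ℂ X]
    [LocallyConvexSpace ℝ X] [CompleteSpace X] [T2Space Y] (hY : HasApproximation Y) :
    DenseRange (tensorMap X Y) := by
  intro φ
  rw [mem_closure_iff_nhds_zero]
  intro W hW
  obtain ⟨⟨U, V⟩, ⟨hU, hV⟩, hUV⟩ := hasBasis_nhds_zero_primaryTensor.mem_iff.1 hW
  let φ' : StarDual X →L[ℂ] Y := (UniformConvergenceCLM.ofFun _ _ _).symm φ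
  obtain ⟨T, hT, hTV⟩ := hY _ (totallyBounded_image_polarSet φ' hU) V hV
  obtain ⟨z, hz⟩ := comp_mem_range_tensorMap φ' T hT
  refine ⟨_, ⟨z, rfl⟩, hUV fun f hf => ?_⟩
  have : (tensorMap X Y z - φ) f = T (φ' f) - φ' f := by
    rw [← hz]; rfl
  rw [this]
  exact hTV _ (mem_image_of_mem _ hf)

end TensorMap

/-! ### Extension to the completion -/

section Completion

/-- A linear uniform embedding with dense range into a complete Hausdorff space extends to an
isomorphism of the completion. -/
theorem exists_completion_equiv {E F : Type*} [AddCommGroup E] [Module ℂ E] [UniformSpace E]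
    [IsUniformAddGroup E] [UniformContinuousConstSMul ℂ E] [AddCommGroup F] [Module ℂ F]
    [UniformSpace F] [IsUniformAddGroup F] [ContinuousConstSMul ℂ F] [T2Space F]
    [CompleteSpace F] (j : E →ₗ[ℂ] F) (hj : IsUniformInducing j) (hd : DenseRange j) :
    ∃ Φ : UniformSpace.Completion E ≃L[ℂ] F, ∀ z : E, Φ z = j z := by
  have : UniformContinuousConstSMul ℂ F := uniformContinuousConstSMul_of_continuousConstSMul ℂ F
  let J : E →L[ℂ] F := ⟨j, hj.uniformContinuous.continuous⟩
  -- `F` with `j` is itself a Hausdorff completion of `E`, so the extension of `j` is invertible.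
  let e : UniformSpace.Completion E ≃ᵤ F := (UniformSpace.Completion.cPkg (α := E)).compareEquiv
    { space := F
      coe := j
      uniformStruct := inferInstance
      complete := inferInstance
      separation := inferInstance
      isUniformInducing := hj
      dense := hd }
  refine ⟨{ J.fromCompletion.toLinearMap with
    invFun := e.symm
    left_inv := e.left_inv
    right_inv := e.right_inv
    continuous_toFun := J.fromCompletion.continuous
    continuous_invFun := e.symm.continuous }, fun z => J.fromCompletion_apply_coe z⟩

end Completion

/-! ### The projective topology and nuclearity -/

section Projective

variable {X : Type*} [AddCommGroup X] [Module ℂ X] [UniformSpace X] [IsUniformAddGroup X]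
  [ContinuousSMul ℂ X] [LocallyConvexSpace ℝ X]
  {Y : Type*} [AddCommGroup Y] [Module ℂ Y] [UniformSpace Y] [IsUniformAddGroup Y]
  [ContinuousSMul ℂ Y] [LocallyConvexSpace ℝ Y]

theorem continuous_rankOne : Continuous fun p : X × Y => rankOne p.1 p.2 := by
  let B : X →+ Y →+ PrimaryTensor X Y := AddMonoidHom.mk' (fun x => AddMonoidHom.mk' (rankOne x)
    fun y y' => UniformConvergenceCLM.ext _ _ fun f => smul_add (f x) y y')
    fun x x' => AddMonoidHom.ext fun y => UniformConvergenceCLM.ext _ _ fun f => by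
      change f (x + x') • y = f x • y + f x' • y
      rw [map_add, add_smul]
  have key : ∀ w : X × Y, w.1 = 0 ∨ w.2 = 0 →
      Tendsto (fun w : X × Y => rankOne w.1 w.2) (𝓝 w) (𝓝 0) := by
    intro w hw
    rw [hasBasis_nhds_zero_primaryTensor.tendsto_right_iff]
    rintro ⟨U, V⟩ ⟨hU, hV⟩
    obtain ⟨p, hp, hpU⟩ := exists_continuous_seminorm hU
    obtain ⟨q, hq, hqV⟩ := exists_continuous_seminorm hV
    have hc : Continuous fun w : X × Y => p w.1 * q w.2 := by fun_prop
    have h0 : p w.1 * q w.2 < 1 := by rcases hw with h | h <;> simp [h]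
    filter_upwards [hc.continuousAt.eventually_lt_const h0] with v hv f hf
    refine hqV _ ?_
    rw [rankOne_apply, map_smul_eq_mul]
    exact (mul_le_mul_of_nonneg_right (norm_le_of_mem_polarSet_closedBall
      (polarSet_mono hpU hf) _) (apply_nonneg q _)).trans hv.le
  refine continuous_of_continuousAt_zero₂ B ?_ (fun x => ?_) (fun y => ?_)
  · have h : B (0 : X) (0 : Y) = 0 := map_zero (B 0)
    rw [ContinuousAt, h]
    exact key (0, 0) (Or.inl rfl)
  · rw [ContinuousAt, map_zero]
    exact (key (x, 0) (Or.inr rfl)).comp (Continuous.prodMk_right x).continuousAt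
  · have h : rankOne (0 : X) y = 0 := map_zero (B.flip y)
    have h1 : Tendsto (fun x : X => (x, y)) (𝓝 0) (𝓝 (0, y)) :=
      (Continuous.prodMk_left y).tendsto 0
    change Tendsto (fun x : X => rankOne x y) (𝓝 0) (𝓝 (rankOne 0 y))
    rw [h]
    have h2 := key ((0 : X), y) (Or.inl rfl)
    exact Tendsto.comp (f := fun x : X => (x, y)) h2 h1

omit [LocallyConvexSpace ℝ Y] in
/-- A seminorm on the tensor product bounded by a cross-product of seminorms is, when the second
factor satisfies the nuclearity estimate, bounded by an injective seminorm. -/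
theorem seminorm_le_of_nuclear (r : Seminorm ℂ (X ⊗[ℂ] Y)) {p : Seminorm ℂ X} (hp : Continuous p)
    {p' q : Seminorm ℂ Y} (hr : ∀ x y, r (x ⊗ₜ y) ≤ p x * p' y)
    {f : ℕ → Y →ₗ[ℂ] ℂ} {y : ℕ → Y} {c : ℕ → ℝ≥0} (hf : ∀ n x, ‖f n x‖ ≤ c n * q x)
    (hc : Summable fun n => (c n : ℝ) * p' (y n))
    (hlim : ∀ x, Tendsto (fun N => p' (x - ∑ n ∈ Finset.range N, f n x • y n)) atTop (𝓝 0))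
    {z : X ⊗[ℂ] Y} {M : ℝ} (hM : 0 ≤ M)
    (hz : ∀ φ ∈ polarSet {x | p x ≤ 1}, q (tensorMap X Y z φ) ≤ M) :
    r z ≤ (∑' n, (c n : ℝ) * p' (y n)) * M := by
  let P : ℕ → Y →ₗ[ℂ] Y := fun N => ∑ n ∈ Finset.range N, (f n).smulRight (y n)
  have hP : ∀ N x, P N x = ∑ n ∈ Finset.range N, f n x • y n := fun N x => by simp [P]
  -- The slice `(id ⊗ fₙ) w`. A functional `φ` on it gives `fₙ` of the operator `w` at `φ`, so the
  -- supremum over the polar of the `p`-ball bounds its `p`-value by `cₙ M`.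
  let s : ℕ → X ⊗[ℂ] Y →ₗ[ℂ] X := fun n => TensorProduct.rid ℂ X ∘ₗ (f n).lTensor X
  have hconv : ∀ w : X ⊗[ℂ] Y, Tendsto (fun N => r (w - (P N).lTensor X w)) atTop (𝓝 0) := by
    intro w
    induction w with
    | zero => simp
    | tmul x v =>
      have h1 := (hlim v).const_mul (p x)
      rw [mul_zero] at h1
      refine squeeze_zero (fun N => apply_nonneg r _) (fun N => ?_) h1
      rw [LinearMap.lTensor_tmul, ← TensorProduct.tmul_sub, hP]
      exact hr _ _
    | add w w' h h' =>
      have h1 := h.add h'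
      rw [add_zero] at h1
      refine squeeze_zero (fun N => apply_nonneg r _) (fun N => ?_) h1
      rw [map_add, add_sub_add_comm]
      exact map_add_le_add r _ _
  have hsum : ∀ N (w : X ⊗[ℂ] Y), (P N).lTensor X w = ∑ n ∈ Finset.range N, s n w ⊗ₜ y n := by
    intro N w
    induction w with
    | zero => simp
    | tmul x v =>
      simp only [LinearMap.lTensor_tmul, hP, TensorProduct.tmul_sum, s, LinearMap.comp_apply,
        LinearEquiv.coe_coe, TensorProduct.rid_tmul, TensorProduct.smul_tmul]
    | add w w' h h' =>
      simp only [map_add, h, h', TensorProduct.add_tmul, Finset.sum_add_distrib]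
  have hs : ∀ n (w : X ⊗[ℂ] Y) (φ : StarDual X), φ (s n w) = f n (tensorMap X Y w φ) := by
    intro n w φ
    induction w with
    | zero => simp
    | tmul x v => simp [s, mul_comm]
    | add w w' h h' => rw [map_add, map_add, h, h', map_add, add_apply, map_add]
  have hps : ∀ n, p (s n z) ≤ c n * M := fun n =>
    seminorm_le_of_forall_mem_polarSet hp fun φ hφ => by
      rw [hs]
      exact (hf n _).trans (mul_le_mul_of_nonneg_left (hz φ hφ) (c n).2)
  have hbound : ∀ N, r z ≤ r (z - (P N).lTensor X z) + (∑' n, (c n : ℝ) * p' (y n)) * M := by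
    intro N
    have h1 : r z ≤ r (z - (P N).lTensor X z) + r ((P N).lTensor X z) := by
      simpa using map_add_le_add r (z - (P N).lTensor X z) ((P N).lTensor X z)
    refine h1.trans (add_le_add le_rfl ?_)
    rw [hsum]
    calc r (∑ n ∈ Finset.range N, s n z ⊗ₜ y n)
        ≤ ∑ n ∈ Finset.range N, r (s n z ⊗ₜ y n) :=
          Finset.le_sum_of_subadditive r (map_zero r).le (map_add_le_add r) _ _
      _ ≤ ∑ n ∈ Finset.range N, ((c n : ℝ) * p' (y n)) * M := by
          refine Finset.sum_le_sum fun n _ => (hr _ _).trans ?_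
          rw [mul_right_comm]
          exact mul_le_mul_of_nonneg_right (hps n) (apply_nonneg p' _)
      _ ≤ (∑' n, (c n : ℝ) * p' (y n)) * M := by
          rw [← Finset.sum_mul]
          exact mul_le_mul_of_nonneg_right (hc.sum_le_tsum _ fun n _ =>
            mul_nonneg (c n).2 (apply_nonneg p' _)) hM
  have h2 := (hconv z).add_const ((∑' n, (c n : ℝ) * p' (y n)) * M)
  rw [zero_add] at h2
  exact ge_of_tendsto' h2 hbound

variable (X Y) in
/-- The canonical map, with the projective topology on its source. -/
def projMap : ProjTensor X Y →ₗ[ℂ] PrimaryTensor X Y := tensorMap X Y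

/-- The topology induced from `X · Y` is admissible, and `π` is the finest admissible one. -/
theorem continuous_projMap : Continuous (projMap X Y) := by
  rw [continuous_iff_le_induced]
  have : ContinuousSMul ℝ Y := IsScalarTower.continuousSMul ℂ
  refine sInf_le ⟨topologicalAddGroup_induced _, continuousSMul_induced _,
    LocallyConvexSpace.induced ((projMap X Y).restrictScalars ℝ), ?_⟩
  rw [continuous_induced_rng]
  exact continuous_rankOne

/-- A continuous seminorm on the projective tensor product is dominated on elementary tensors by a
product of continuous seminorms. -/
theorem exists_seminorm_tmul_le (r : Seminorm ℂ (ProjTensor X Y)) (hr : Continuous r) :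
    ∃ (p : Seminorm ℂ X) (p' : Seminorm ℂ Y), Continuous p ∧ Continuous p' ∧
      ∀ x y, r (ProjTensor.tmul x y) ≤ p x * p' y := by
  have h1 : {w : X × Y | r (ProjTensor.tmul w.1 w.2) ≤ 1} ∈ 𝓝 ((0 : X), (0 : Y)) := by
    have h2 : Continuous fun w : X × Y => r (ProjTensor.tmul w.1 w.2) :=
      hr.comp (projTopology_mem X Y).2.2.2
    have h3 : r (ProjTensor.tmul (0 : X) (0 : Y)) < 1 := by
      have : ProjTensor.tmul (0 : X) (0 : Y) = 0 := TensorProduct.zero_tmul X (0 : Y)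
      rw [this, map_zero]
      exact one_pos
    filter_upwards [h2.continuousAt.eventually_lt_const h3] with w hw using hw.le
  obtain ⟨U, hU, V, hV, hUV⟩ := mem_nhds_prod_iff.1 h1
  obtain ⟨p, hp, hpU⟩ := exists_continuous_seminorm hU
  obtain ⟨p', hp', hpV⟩ := exists_continuous_seminorm hV
  refine ⟨p, p', hp, hp', fun x y => ?_⟩
  -- Strict bounds keep `s` and `t` positive even where the seminorms vanish, so the vectors can be
  -- rescaled.
  have key : ∀ s t : ℝ, p x < s → p' y < t → r (ProjTensor.tmul x y) ≤ s * t := by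
    intro s t hs ht
    have hs0 : 0 < s := (apply_nonneg p x).trans_lt hs
    have ht0 : 0 < t := (apply_nonneg p' y).trans_lt ht
    have a1 : p (((s⁻¹ : ℝ) : ℂ) • x) ≤ 1 := by
      rw [map_smul_eq_mul, Complex.norm_real, Real.norm_of_nonneg (by positivity),
        inv_mul_le_iff₀ hs0, mul_one]
      exact hs.le
    have a2 : p' (((t⁻¹ : ℝ) : ℂ) • y) ≤ 1 := by
      rw [map_smul_eq_mul, Complex.norm_real, Real.norm_of_nonneg (by positivity),
        inv_mul_le_iff₀ ht0, mul_one]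
      exact ht.le
    have a3 : r (ProjTensor.tmul (((s⁻¹ : ℝ) : ℂ) • x) (((t⁻¹ : ℝ) : ℂ) • y)) ≤ 1 :=
      @hUV (_, _) ⟨hpU _ a1, hpV _ a2⟩
    have a4 : ProjTensor.tmul (((s⁻¹ : ℝ) : ℂ) • x) (((t⁻¹ : ℝ) : ℂ) • y) =
        (((s * t)⁻¹ : ℝ) : ℂ) • ProjTensor.tmul x y := by
      refine (TensorProduct.smul_tmul_smul (R := ℂ) _ _ x y).trans ?_
      rw [mul_inv, Complex.ofReal_mul]
      rfl
    rw [a4, map_smul_eq_mul, Complex.norm_real, Real.norm_of_nonneg (by positivity),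
      inv_mul_le_iff₀ (by positivity), mul_one] at a3
    exact a3
  have hlim : Tendsto (fun ε : ℝ => (p x + ε) * (p' y + ε)) (𝓝[>] 0) (𝓝 (p x * p' y)) := by
    have : Continuous fun ε : ℝ => (p x + ε) * (p' y + ε) := by fun_prop
    exact (this.tendsto' 0 _ (by simp)).mono_left nhdsWithin_le_nhds
  refine ge_of_tendsto hlim ?_
  filter_upwards [self_mem_nhdsWithin] with ε hε
  have : (0 : ℝ) < ε := hε
  exact key _ _ (by linarith) (by linarith)

theorem isUniformInducing_projMap (hY : IsNuclear Y) : IsUniformInducing (projMap X Y) := by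
  refine AddMonoidHom.isUniformInducing_of_isInducing (f := projMap X Y) ?_
  rw [IsTopologicalAddGroup.isInducing_iff_nhds_zero]
  refine le_antisymm ?_ ?_
  · rw [← Filter.map_le_iff_le_comap]
    exact continuous_projMap.tendsto' 0 0 (map_zero _)
  intro W hW
  have : LocallyConvexSpace ℝ (ProjTensor X Y) := (projTopology_mem X Y).2.2.1
  obtain ⟨r, hr, hrW⟩ := exists_continuous_seminorm hW
  obtain ⟨p, p', hp, hp', hpp⟩ := exists_seminorm_tmul_le r hr
  obtain ⟨q, hq, -, f, y, c, hf, hc, hlim⟩ := hY p' hp'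
  set C := ∑' n, (c n : ℝ) * p' (y n) with hC
  have hC0 : 0 ≤ C := tsum_nonneg fun n => mul_nonneg (c n).2 (apply_nonneg p' _)
  -- `C` may be zero; with this radius the estimate yields `r z ≤ C / (C + 1) ≤ 1`.
  have hδ : 0 < (C + 1)⁻¹ := by positivity
  refine ⟨_, hasBasis_nhds_zero_primaryTensor.mem_of_mem (i := ({x | p x ≤ 1},
    {y | q y ≤ (C + 1)⁻¹})) ⟨seminorm_closedBall_mem_nhds p hp one_pos,
      seminorm_closedBall_mem_nhds q hq hδ⟩, fun z hz => hrW z ?_⟩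
  refine (seminorm_le_of_nuclear r hp hpp hf hc hlim hδ.le hz).trans ?_
  rw [← div_eq_mul_inv, div_le_one (by positivity)]
  linarith

end Projective

end StereotypeTensor

end

theorem mainTheorem6 {X : Type*} {Y : Type*}
    [AddCommGroup X] [Module ℂ X] [UniformSpace X] [IsUniformAddGroup X]
    [ContinuousSMul ℂ X] [LocallyConvexSpace ℝ X] [T2Space X] [CompleteSpace X]
    [AddCommGroup Y] [Module ℂ Y] [UniformSpace Y] [IsUniformAddGroup Y]
    [ContinuousSMul ℂ Y] [LocallyConvexSpace ℝ Y] [T2Space Y] [CompleteSpace Y]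
    (hY : StereotypeTensor.HasApproximation Y) :
    (∃ Φ : StereotypeTensor.CompletedInjTensor X Y ≃L[ℂ] StereotypeTensor.PrimaryTensor X Y,
      ∀ (x : X) (y : Y) (f : StereotypeTensor.StarDual X),
        Φ ((StereotypeTensor.InjTensor.tmul x y : StereotypeTensor.InjTensor X Y) :
          StereotypeTensor.CompletedInjTensor X Y) f = f x • y) ∧
    (StereotypeTensor.IsNuclear Y →
      (∃ Ψ : StereotypeTensor.CompletedProjTensor X Y ≃L[ℂ] StereotypeTensor.PrimaryTensor X Y,
        ∀ (x : X) (y : Y) (f : StereotypeTensor.StarDual X),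
          Ψ ((StereotypeTensor.ProjTensor.tmul x y : StereotypeTensor.ProjTensor X Y) :
            StereotypeTensor.CompletedProjTensor X Y) f = f x • y) ∧
      (∃ Θ : StereotypeTensor.CompletedInjTensor X Y ≃L[ℂ]
          StereotypeTensor.CompletedProjTensor X Y,
        ∀ (x : X) (y : Y),
          Θ ((StereotypeTensor.InjTensor.tmul x y : StereotypeTensor.InjTensor X Y) :
            StereotypeTensor.CompletedInjTensor X Y) =
          ((StereotypeTensor.ProjTensor.tmul x y : StereotypeTensor.ProjTensor X Y) :
            StereotypeTensor.CompletedProjTensor X Y))) := by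
  -- Density concerns only the range in `X · Y`, so it serves both topologies on the source.
  have hd := StereotypeTensor.denseRange_tensorMap (X := X) hY
  obtain ⟨Φ, hΦ⟩ := StereotypeTensor.exists_completion_equiv (StereotypeTensor.injMap X Y)
    StereotypeTensor.isUniformInducing_injMap hd
  refine ⟨⟨Φ, fun x y f => by rw [hΦ]; rfl⟩, fun hN => ?_⟩
  obtain ⟨Ψ, hΨ⟩ := StereotypeTensor.exists_completion_equiv (StereotypeTensor.projMap X Y)
    (StereotypeTensor.isUniformInducing_projMap hN) hd
  refine ⟨⟨Ψ, fun x y f => by rw [hΨ]; rfl⟩, Φ.trans Ψ.symm, fun x y => ?_⟩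
  rw [ContinuousLinearEquiv.trans_apply, ContinuousLinearEquiv.symm_apply_eq, hΦ, hΨ]
  rfl
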